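/- Let $L^2=L^2(\mathbb{T})$ be taken with respect to normalised Lebesgue measure on the unit circle $\mathbb{T}$, and let $H^2\subseteq L^2$ be the Hardy space, i.e. the subspace of functions whose Fourier coefficients of negative index vanish. Let $\theta$ be an inner function (that is, $\theta\in H^2$ and $|\theta|=1$ a.e. on $\mathbb{T}$), let $K_\theta=\theta\,\overline{H^2_0}\cap H^2$ with $\overline{H^2_0}=\{\overline{h}:h\in H^2,\ h(0)=0\}$ be the corresponding model space, and let $P_\theta:L^2\to K_\theta$ be the orthogonal projection. For $g\in L^2$ let $A_g^\theta$ be the truncated Toeplitz operator, i.e. the (possibly unbounded) operator in $K_\theta$ with domain $\{f\in K_\theta: gf\in L^2\}$ given by $A_g^\theta f=P_\theta(gf)$. A function $u\in H^2$ is called outer if the closed linear span of $\{z^nu:n\ge 0\}$ is $H^2$. Then for every $g\in L^2$ there exists an outer function $u\in H^2$ with $|u|=2|g|+1$ a.e. on $\mathbb{T}$; and for every such $u$ the function $\tilde g:=g-\overline{\theta u}$ belongs to $L^2$, satisfies $A_g^\theta=A_{\tilde g}^\theta$ (equality of operators, including equality of their domains), is nonzero a.e. on $\mathbb{T}$, and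 satisfies $\tilde g^{-1}\in L^\infty$. In particular, every truncated Toeplitz operator $A_g^\theta$ with $g\in L^2$ has a symbol $\tilde g\in L^2$ with $\tilde g^{-1}\in L^\infty$. -/

import Mathlib

open MeasureTheory AddCircle
open scoped ENNReal ComplexConjugate

noncomputable section

namespace HardyTTO

instance factTwoPiPos : Fact (0 < 2 * Real.pi) := ⟨Real.two_pi_pos⟩

/-- The unit circle, parametrised by `t ↦ e^{it}`, `t ∈ ℝ / 2πℤ`. The function `z ^ n` on the circle
is Mathlib's `fourier n`. -/
abbrev UnitCircle : Type := AddCircle (2 * Real.pi)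

/-- Normalised Lebesgue measure on the unit circle. -/
abbrev circleMeasure : Measure UnitCircle := haarAddCircle

/-- The Hilbert space `L²(𝕋)`. -/
abbrev L2 : Type := Lp ℂ 2 circleMeasure

lemma inner_fourierLp (n : ℤ) (f : L2) :
    inner ℂ (fourierLp 2 n : L2) f = fourierCoeff f n := by
  rw [← fourierBasis_repr, HilbertBasis.repr_apply_apply, coe_fourierBasis]

/-- The Hardy space `H²` (as boundary functions): the functions in `L²(𝕋)` all of whose Fourier
coefficients of negative index vanish. -/
def H2 : Submodule ℂ L2 where
  carrier := {f | ∀ n : ℤ, n < 0 → fourierCoeff f n = 0}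
  zero_mem' n _ := by rw [← inner_fourierLp, inner_zero_right]
  add_mem' {f g} hf hg n hn := by
    rw [← inner_fourierLp, inner_add_right, inner_fourierLp, inner_fourierLp, hf n hn, hg n hn,
      add_zero]
  smul_mem' c f hf n hn := by
    rw [← inner_fourierLp, inner_smul_right, inner_fourierLp, hf n hn, mul_zero]

/-- `θ` is an inner function: `θ ∈ H²` (equivalently, `θ ∈ H^∞`) and `|θ| = 1` a.e. on `𝕋`. -/
def IsInner (θ : L2) : Prop :=
  θ ∈ H2 ∧ ∀ᵐ t ∂circleMeasure, ‖θ t‖ = 1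

/-- `u` is an outer function of class `H²`: `u ∈ H²` and the closed linear span of the functions
`z ^ n u`, `n ≥ 0`, is the whole of `H²`. -/
def IsOuter (u : L2) : Prop :=
  u ∈ H2 ∧
    (Submodule.span ℂ {f : L2 | ∃ n : ℕ, f =ᵐ[circleMeasure]
      fun t => fourier (n : ℤ) t * u t}).topologicalClosure = H2

/-- The model space `K_θ = θ \overline{H²₀} ∩ H²`, where `H²₀ = {h ∈ H² : h(0) = 0}` and `h(0)` is
the Fourier coefficient of `h` of index `0`. -/
def modelSpace (θ : L2) : Submodule ℂ L2 where
  carrier := {f | f ∈ H2 ∧ ∃ h ∈ H2, fourierCoeff h 0 = 0 ∧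
    f =ᵐ[circleMeasure] fun t => θ t * conj (h t)}
  zero_mem' := by
    refine ⟨H2.zero_mem, 0, H2.zero_mem, ?_, ?_⟩
    · rw [← inner_fourierLp, inner_zero_right]
    · filter_upwards with t
      simp
  add_mem' := by
    rintro f₁ f₂ ⟨hf₁, h₁, hh₁, h₁0, e₁⟩ ⟨hf₂, h₂, hh₂, h₂0, e₂⟩
    refine ⟨H2.add_mem hf₁ hf₂, h₁ + h₂, H2.add_mem hh₁ hh₂, ?_, ?_⟩
    · rw [← inner_fourierLp, inner_add_right, inner_fourierLp, inner_fourierLp, h₁0, h₂0, add_zero]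
    · filter_upwards [e₁, e₂, Lp.coeFn_add f₁ f₂, Lp.coeFn_add h₁ h₂] with t a b c d
      rw [c, Pi.add_apply, a, b, d, Pi.add_apply, map_add, mul_add]
  smul_mem' := by
    rintro c f ⟨hf, h, hh, h0, e⟩
    refine ⟨H2.smul_mem c hf, conj c • h, H2.smul_mem _ hh, ?_, ?_⟩
    · rw [← inner_fourierLp, inner_smul_right, inner_fourierLp, h0, mul_zero]
    · filter_upwards [e, Lp.coeFn_smul c f, Lp.coeFn_smul (conj c) h] with t a b d
      rw [b, Pi.smul_apply, a, d, Pi.smul_apply, smul_eq_mul, smul_eq_mul, map_mul,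
        Complex.conj_conj]
      ring

lemma isClosed_H2 : IsClosed (H2 : Set L2) := by
  have : (H2 : Set L2) = ⋂ n : ℤ, ⋂ _ : n < 0, {f : L2 | inner ℂ (fourierLp 2 n : L2) f = 0} := by
    ext f
    simp only [Set.mem_iInter, Set.mem_ofPred_eq, inner_fourierLp]
    rfl
  rw [this]
  exact isClosed_iInter fun n => isClosed_iInter fun _ =>
    isClosed_eq (continuous_const.inner continuous_id) continuous_const

lemma memLp_inner_mul {θ : L2} (hθ : IsInner θ) {f : UnitCircle → ℂ} (hf : MemLp f 2 circleMeasure) :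
    MemLp (fun t => θ t * f t) 2 circleMeasure := by
  refine hf.of_le ((Lp.aestronglyMeasurable θ).mul hf.1) ?_
  filter_upwards [hθ.2] with t ht
  rw [norm_mul, ht, one_mul]

/-- For an inner function `θ`, an element `f ∈ H²` is in `K_θ` iff it is orthogonal to `θ z ^ n` for
all `n ≥ 0`. It yields that `K_θ` is closed. -/
lemma mem_modelSpace_iff {θ : L2} (hθ : IsInner θ) (f : L2) :
    f ∈ modelSpace θ ↔ f ∈ H2 ∧ ∀ n : ℕ,
      inner ℂ ((memLp_inner_mul hθ (Lp.memLp (fourierLp 2 (n : ℤ) : L2))).toLp _ : L2) f = 0 := by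
  have key : ∀ (h : L2), (f =ᵐ[circleMeasure] fun t => θ t * conj (h t)) → ∀ n : ℕ,
      inner ℂ ((memLp_inner_mul hθ (Lp.memLp (fourierLp 2 (n : ℤ) : L2))).toLp _ : L2) f
        = conj (fourierCoeff h (-(n : ℤ))) := by
    intro h e n
    rw [← inner_fourierLp, L2.inner_def, L2.inner_def, ← integral_conj]
    refine integral_congr_ae ?_
    filter_upwards [e, hθ.2, MemLp.coeFn_toLp (memLp_inner_mul hθ
      (Lp.memLp (fourierLp 2 (n : ℤ) : L2))), coeFn_fourierLp (T := 2 * Real.pi) 2 (n : ℤ),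
      coeFn_fourierLp (T := 2 * Real.pi) 2 (-(n : ℤ))] with t a b c d d'
    have hb : conj (θ t) * θ t = 1 := by
      rw [Complex.conj_mul', b]; simp
    simp only [RCLike.inner_apply, c, d, d', a, map_mul, fourier_neg, Complex.conj_conj]
    linear_combination (conj (h t) * conj (fourier (n : ℤ) t)) * hb
  constructor
  · rintro ⟨hf, h, hh, h0, e⟩
    refine ⟨hf, fun n => ?_⟩
    rw [key h e n]
    rcases Nat.eq_zero_or_pos n with rfl | hn
    · simpa using h0
    · rw [hh _ (by omega), map_zero]
  · rintro ⟨hf, hn⟩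
    have hm : MemLp (fun t => θ t * conj (f t)) 2 circleMeasure :=
      memLp_inner_mul hθ (Lp.memLp f).star
    have e : f =ᵐ[circleMeasure] fun t => θ t * conj (hm.toLp _ t) := by
      filter_upwards [hθ.2, hm.coeFn_toLp] with t b c
      have hb : conj (θ t) * θ t = 1 := by
        rw [Complex.conj_mul', b]; simp
      rw [c, map_mul, Complex.conj_conj]
      linear_combination (-(f t)) * hb
    have hz : ∀ n : ℕ, fourierCoeff (hm.toLp _ : L2) (-(n : ℤ)) = 0 := fun n => by
      have := (key _ e n).symm.trans (hn n)
      simpa using this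
    refine ⟨hf, hm.toLp _, fun m hm0 => ?_, by simpa using hz 0, e⟩
    have := hz m.natAbs
    rwa [show (-(m.natAbs : ℤ)) = m by omega] at this

lemma isClosed_modelSpace {θ : L2} (hθ : IsInner θ) : IsClosed (modelSpace θ : Set L2) := by
  have : (modelSpace θ : Set L2) = (H2 : Set L2) ∩ ⋂ n : ℕ, {f : L2 |
      inner ℂ ((memLp_inner_mul hθ (Lp.memLp (fourierLp 2 (n : ℤ) : L2))).toLp _ : L2) f = 0} := by
    ext f
    simpa using mem_modelSpace_iff hθ f
  rw [this]
  exact isClosed_H2.inter (isClosed_iInter fun n =>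
    isClosed_eq (continuous_const.inner continuous_id) continuous_const)

lemma hasOrthogonalProjection_modelSpace {θ : L2} (hθ : IsInner θ) :
    (modelSpace θ).HasOrthogonalProjection :=
  haveI : CompleteSpace (modelSpace θ) := (isClosed_modelSpace hθ).completeSpace_coe
  inferInstance

/-- The orthogonal projection `P_θ : L² → K_θ`. -/
def modelProj {θ : L2} (hθ : IsInner θ) : L2 →L[ℂ] modelSpace θ :=
  haveI := hasOrthogonalProjection_modelSpace hθ
  (modelSpace θ).orthogonalProjectionOnto

lemma memLp_mul_add {g f₁ f₂ : L2} (h₁ : MemLp (fun t => g t * f₁ t) 2 circleMeasure)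
    (h₂ : MemLp (fun t => g t * f₂ t) 2 circleMeasure) :
    MemLp (fun t => g t * (f₁ + f₂ : L2) t) 2 circleMeasure := by
  refine (h₁.add h₂).ae_eq ?_
  filter_upwards [Lp.coeFn_add f₁ f₂] with t ht
  rw [ht, Pi.add_apply, Pi.add_apply, mul_add]

lemma memLp_mul_smul {g f : L2} (c : ℂ) (h : MemLp (fun t => g t * f t) 2 circleMeasure) :
    MemLp (fun t => g t * (c • f : L2) t) 2 circleMeasure := by
  refine (h.const_smul c).ae_eq ?_
  filter_upwards [Lp.coeFn_smul c f] with t ht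
  simp only [ht, Pi.smul_apply, smul_eq_mul]
  ring

/-- The truncated Toeplitz operator `A_g^θ f = P_θ (g f)` with symbol `g ∈ L²`, as a possibly
unbounded operator in `K_θ` with domain `{f ∈ K_θ : g f ∈ L²}`. Two such operators are equal iff they
have the same domain and agree on it. -/
def truncatedToeplitz {θ : L2} (hθ : IsInner θ) (g : L2) : modelSpace θ →ₗ.[ℂ] modelSpace θ where
  domain :=
    { carrier := {f | MemLp (fun t => g t * (f : L2) t) 2 circleMeasure}
      zero_mem' := by
        refine MemLp.zero.ae_eq (μ := circleMeasure) (f := fun _ => (0 : ℂ)) ?_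
        filter_upwards with t
        simp
      add_mem' := fun h₁ h₂ => memLp_mul_add h₁ h₂
      smul_mem' := fun c _ h => memLp_mul_smul c h }
  toFun :=
    { toFun := fun f => modelProj hθ (MemLp.toLp (fun t => g t * ((f : modelSpace θ) : L2) t) f.2)
      map_add' := fun f₁ f₂ => by
        rw [← map_add, ← MemLp.toLp_add]
        congr 1
        refine MemLp.toLp_congr _ _ ?_
        filter_upwards [Lp.coeFn_add ((f₁ : modelSpace θ) : L2) ((f₂ : modelSpace θ) : L2)] with t ht
        simp only [Submodule.coe_add, ht, Pi.add_apply, mul_add]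
      map_smul' := fun c f => by
        rw [RingHom.id_apply, ← map_smul, ← MemLp.toLp_const_smul]
        congr 1
        refine MemLp.toLp_congr _ _ ?_
        filter_upwards [Lp.coeFn_smul c ((f : modelSpace θ) : L2)] with t ht
        simp only [Submodule.coe_smul, ht, Pi.smul_apply, smul_eq_mul]
        ring }

end HardyTTO

end

open HardyTTO

/-!
Outer functions of prescribed modulus come from wandering vectors. If `W` does not lie in the closed
span `[zW]` of `{z ^ n W : n ≥ 1}`, then `F = W - P_{[zW]} W` is orthogonal to all its shifts
`z ^ n F` with `n ≥ 1`. These inner products are the nonconstant Fourier coefficients of `|F|²`,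
so `|F|` is constant and `φ = F / ‖F‖` is unimodular. The function `u = conj φ * W` has the modulus
of `W`; it is in `H²` because `φ ⟂ [zW]`, and it is outer because `φ ∈ [W]` gives
`1 = conj φ * φ ∈ [u]`.

For the change of symbol, `f = θ * conj h` in `K_θ` gives `conj (θ u) * f = conj u * conj h`, which
is orthogonal to `H²`; hence subtracting `conj (θ u)` from `g` does not affect the compression to
`K_θ`. If `|u| = 2|g| + 1`, the new symbol has modulus between `|g| + 1` and `3|g| + 1`, so it is
bounded away from zero and multiplication by it has the same domain as multiplication by `g`.
-/

namespace HardyTTO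

open Filter Topology

noncomputable section

section ContinuousTestFunctions

variable {X E : Type*} [TopologicalSpace X] [MeasurableSpace X] [BorelSpace X]
  [HasOuterApproxClosed X] [NormedAddCommGroup E] [NormedSpace ℝ E] {μ : Measure X}

lemma tendsto_integral_apprSeq_smul {f : X → E} (hf : Integrable f μ) {s : Set X}
    (hs : IsClosed s) :
    Tendsto (fun n => ∫ x, (hs.apprSeq n x : ℝ) • f x ∂μ) atTop (𝓝 (∫ x in s, f x ∂μ)) := by
  rw [← integral_indicator hs.measurableSet]
  refine tendsto_integral_of_dominated_convergence (fun x => ‖f x‖) (fun n => ?_) hf.norm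
    (fun n => .of_forall fun x => ?_) (.of_forall fun x => ?_)
  · exact (NNReal.continuous_coe.comp
      (hs.apprSeq n).continuous).aestronglyMeasurable.smul hf.aestronglyMeasurable
  · rw [norm_smul, NNReal.norm_eq]
    exact mul_le_of_le_one_left (norm_nonneg _)
      (mod_cast HasOuterApproxClosed.apprSeq_apply_le_one hs n x)
  · have h : Tendsto (fun n => (hs.apprSeq n x : ℝ)) atTop (𝓝 (s.indicator (fun _ => 1) x)) := by
      have := NNReal.tendsto_coe.2
        (tendsto_pi_nhds.1 (HasOuterApproxClosed.tendsto_apprSeq hs) x)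
      by_cases hx : x ∈ s <;> simpa [hx] using this
    have := h.smul_const (f x)
    by_cases hx : x ∈ s <;> simpa [hx] using this

lemma ae_eq_zero_of_forall_integral_continuous_smul_eq_zero [CompleteSpace E] {f : X → E}
    (hf : Integrable f μ) (h : ∀ φ : C(X, ℝ), ∫ x, φ x • f x ∂μ = 0) : f =ᵐ[μ] 0 :=
  ae_eq_zero_of_forall_setIntegral_isClosed_eq_zero hf fun _ hs =>
    tendsto_nhds_unique (tendsto_integral_apprSeq_smul hf hs)
      (tendsto_const_nhds.congr fun n =>
        (h ⟨fun x => hs.apprSeq n x, NNReal.continuous_coe.comp (hs.apprSeq n).continuous⟩).symm)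

end ContinuousTestFunctions

section FourierUniqueness

variable {T : ℝ} [Fact (0 < T)] {E : Type*} [NormedAddCommGroup E] [NormedSpace ℂ E]
  [CompleteSpace E] {f : AddCircle T → E}

lemma integral_continuous_smul_eq_zero_of_fourierCoeff_eq_zero
    (hf : Integrable f haarAddCircle) (h : ∀ n, fourierCoeff f n = 0) (φ : C(AddCircle T, ℂ)) :
    ∫ t, φ t • f t ∂haarAddCircle = 0 := by
  let Λ : C(AddCircle T, ℂ) →L[ℂ] E :=
    (((ContinuousLinearMap.lsmul ℂ ℂ).lpPairing haarAddCircle ∞ 1).flip hf.toL1).comp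
      (ContinuousMap.toLp ∞ haarAddCircle ℂ)
  have hΛ (ψ) : Λ ψ = ∫ t, ψ t • f t ∂haarAddCircle := by
    refine ((ContinuousLinearMap.lsmul ℂ ℂ).lpPairing_eq_integral _ _).trans
      (integral_congr_ae ?_)
    filter_upwards [ContinuousMap.coeFn_toLp (p := ∞) (𝕜 := ℂ) haarAddCircle ψ, hf.coeFn_toL1]
      with t hψ hft
    exact congrArg₂ (· • ·) hψ hft
  have hker : (⊤ : Submodule ℂ C(AddCircle T, ℂ)) ≤ Λ.ker := by
    rw [← span_fourier_closure_eq_top]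
    refine Submodule.topologicalClosure_minimal _ (Submodule.span_le.2 ?_) Λ.isClosed_ker
    rintro _ ⟨n, rfl⟩
    have := h (-n)
    rw [fourierCoeff, neg_neg] at this
    exact (hΛ _).trans this
  exact (hΛ φ).symm.trans (hker Submodule.mem_top)

lemma ae_eq_zero_of_fourierCoeff_eq_zero (hf : Integrable f haarAddCircle)
    (h : ∀ n, fourierCoeff f n = 0) : f =ᵐ[haarAddCircle] 0 :=
  ae_eq_zero_of_forall_integral_continuous_smul_eq_zero hf fun φ =>
    integral_continuous_smul_eq_zero_of_fourierCoeff_eq_zero hf h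
      ⟨fun t => (φ t : ℂ), by fun_prop⟩

lemma fourierCoeff_const (c : E) : fourierCoeff (fun _ : AddCircle T => c) = Pi.single 0 c := by
  ext n
  have hone := congrFun (fourierCoeff_fourier (T := T) 0) n
  simp only [fourierCoeff, fourier_zero, smul_eq_mul, mul_one] at hone
  rw [fourierCoeff, integral_smul_const, hone]
  obtain rfl | hn := eq_or_ne n 0
  · simp only [Pi.single_eq_same, one_smul]
  · simp only [Pi.single_eq_of_ne hn, zero_smul]

lemma ae_eq_const_of_fourierCoeff_eq_zero (hf : Integrable f haarAddCircle)
    (h : ∀ n ≠ 0, fourierCoeff f n = 0) : ∀ᵐ t ∂haarAddCircle, f t = fourierCoeff f 0 := by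
  have hcoeff (n : ℤ) : fourierCoeff (f + fun _ => -fourierCoeff f 0) n = 0 := by
    rw [fourierCoeff.add hf (integrable_const _), fourierCoeff_const, Pi.add_apply]
    obtain rfl | hn := eq_or_ne n 0
    · rw [Pi.single_eq_same, add_neg_cancel]
    · rw [h n hn, Pi.single_eq_of_ne hn, add_zero]
  filter_upwards [ae_eq_zero_of_fourierCoeff_eq_zero (hf.add (integrable_const _)) hcoeff]
    with t ht
  exact add_neg_eq_zero.1 ht

end FourierUniqueness

section Multiplication

variable {X 𝕜 : Type*} [MeasurableSpace X] {μ : Measure X} [RCLike 𝕜] {p : ℝ≥0∞}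

lemma memLp_mul_of_norm_le {f g g' : X → 𝕜} {C D : ℝ} (hf : MemLp f p μ)
    (hgf : MemLp (fun x => g x * f x) p μ) (hg' : AEStronglyMeasurable g' μ)
    (h : ∀ᵐ x ∂μ, ‖g' x‖ ≤ C * ‖g x‖ + D) : MemLp (fun x => g' x * f x) p μ := by
  refine ((hgf.norm.const_mul C).add (hf.norm.const_mul D)).of_le (hg'.mul hf.1) ?_
  filter_upwards [h] with x hx
  calc ‖g' x * f x‖ = ‖g' x‖ * ‖f x‖ := norm_mul _ _
    _ ≤ (C * ‖g x‖ + D) * ‖f x‖ := by gcongr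
    _ = C * ‖g x * f x‖ + D * ‖f x‖ := by rw [norm_mul]; ring
    _ ≤ ‖C * ‖g x * f x‖ + D * ‖f x‖‖ := le_abs_self _

lemma memLp_top_inv {f : X → 𝕜} {c : ℝ} (hc : 0 < c) (hf : AEStronglyMeasurable f μ)
    (h : ∀ᵐ x ∂μ, c ≤ ‖f x‖) : MemLp (fun x => (f x)⁻¹) ∞ μ := by
  refine memLp_top_of_bound hf.inv₀ c⁻¹ ?_
  filter_upwards [h] with x hx
  rw [norm_inv]
  gcongr

variable [Fact (1 ≤ p)]

/-- Multiplication by a bounded function, as a bounded operator on `L^p`. -/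
def mulCLM (φ : Lp 𝕜 ∞ μ) : Lp 𝕜 p μ →L[𝕜] Lp 𝕜 p μ :=
  (ContinuousLinearMap.mul 𝕜 𝕜).holderL μ ∞ p p φ

lemma coeFn_mulCLM (φ : Lp 𝕜 ∞ μ) (f : Lp 𝕜 p μ) : mulCLM φ f =ᵐ[μ] fun x => φ x * f x :=
  (ContinuousLinearMap.mul 𝕜 𝕜).coeFn_holder φ f

lemma mulCLM_comm (φ ψ : Lp 𝕜 ∞ μ) (f : Lp 𝕜 p μ) :
    mulCLM φ (mulCLM ψ f) = mulCLM ψ (mulCLM φ f) := by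
  apply Lp.ext
  filter_upwards [coeFn_mulCLM φ (mulCLM ψ f), coeFn_mulCLM ψ f, coeFn_mulCLM ψ (mulCLM φ f),
    coeFn_mulCLM φ f] with x h₁ h₂ h₃ h₄
  rw [h₁, h₂, h₃, h₄, mul_left_comm]

end Multiplication

section Shift

/-- Multiplication by `z ^ n` on `L²(𝕋)`. -/
def fourierMul (n : ℤ) : L2 →L[ℂ] L2 := mulCLM (fourierLp ∞ n)

lemma coeFn_fourierMul (n : ℤ) (f : L2) :
    fourierMul n f =ᵐ[circleMeasure] fun t => fourier n t * f t := by
  filter_upwards [coeFn_mulCLM (fourierLp ∞ n) f, coeFn_fourierLp (T := 2 * Real.pi) ∞ n]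
    with t hmul hn
  rw [fourierMul, hmul, hn]

lemma fourierMul_fourierMul (m n : ℤ) (f : L2) :
    fourierMul m (fourierMul n f) = fourierMul (m + n) f := by
  apply Lp.ext
  filter_upwards [coeFn_fourierMul m (fourierMul n f), coeFn_fourierMul n f,
    coeFn_fourierMul (m + n) f] with t hm hn hmn
  rw [hm, hn, hmn, fourier_add, mul_assoc]

lemma fourierMul_mulCLM (n : ℤ) (φ : Lp ℂ ∞ circleMeasure) (f : L2) :
    fourierMul n (mulCLM φ f) = mulCLM φ (fourierMul n f) :=
  mulCLM_comm _ _ _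

lemma fourierMul_zero (f : L2) : fourierMul 0 f = f := by
  apply Lp.ext
  filter_upwards [coeFn_fourierMul 0 f] with t ht
  rw [ht, fourier_zero, one_mul]

lemma fourierMul_fourierLp (m n : ℤ) :
    fourierMul m (fourierLp 2 n : L2) = fourierLp 2 (m + n) := by
  apply Lp.ext
  filter_upwards [coeFn_fourierMul m (fourierLp 2 n : L2),
    coeFn_fourierLp (T := 2 * Real.pi) 2 n, coeFn_fourierLp (T := 2 * Real.pi) 2 (m + n)]
    with t hmul hn hmn
  rw [hmul, hn, hmn, fourier_add]

lemma inner_fourierMul_left (n : ℤ) (f g : L2) :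
    inner ℂ (fourierMul n f) g = inner ℂ f (fourierMul (-n) g) := by
  rw [L2.inner_def, L2.inner_def]
  refine integral_congr_ae ?_
  filter_upwards [coeFn_fourierMul n f, coeFn_fourierMul (-n) g] with t hf hg
  rw [RCLike.inner_apply, RCLike.inner_apply, hf, hg, map_mul, fourier_neg]
  ring

lemma fourierCoeff_conj_mul (f g : L2) (n : ℤ) :
    fourierCoeff (fun t => conj (f t) * g t) n = inner ℂ (fourierMul n f) g := by
  rw [inner_fourierMul_left, L2.inner_def]
  refine integral_congr_ae ?_
  filter_upwards [coeFn_fourierMul (-n) g] with t hg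
  rw [RCLike.inner_apply, hg, smul_eq_mul]
  ring

lemma fourierCoeff_star (f : L2) (n : ℤ) :
    fourierCoeff (star f : L2) n = conj (fourierCoeff f (-n)) := by
  rw [fourierCoeff, fourierCoeff, ← integral_conj]
  refine integral_congr_ae ?_
  filter_upwards [Lp.coeFn_star f] with t ht
  rw [ht, Pi.star_apply, Complex.star_def, smul_eq_mul, smul_eq_mul, map_mul, neg_neg, fourier_neg]

lemma norm_ae_eq_of_inner_fourierMul_eq_zero {F : L2}
    (hF : ∀ n : ℕ, n ≠ 0 → inner ℂ (fourierMul n F) F = 0) :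
    ∀ᵐ t ∂circleMeasure, ‖F t‖ = ‖F‖ := by
  have hint : Integrable (fun t => conj (F t) * F t) circleMeasure := by
    simpa only [RCLike.inner_apply, mul_comm] using L2.integrable_inner (𝕜 := ℂ) F F
  have hcoeff (n : ℤ) (hn : n ≠ 0) : fourierCoeff (fun t => conj (F t) * F t) n = 0 := by
    rw [fourierCoeff_conj_mul]
    obtain ⟨k, rfl | rfl⟩ := n.eq_nat_or_neg
    · exact hF k (by simpa using hn)
    · rw [inner_fourierMul_left, neg_neg, inner_eq_zero_symm]
      exact hF k (by simpa using hn)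
  filter_upwards [ae_eq_const_of_fourierCoeff_eq_zero hint hcoeff] with t ht
  rw [fourierCoeff_conj_mul, fourierMul_zero, inner_self_eq_norm_sq_to_K, Complex.conj_mul'] at ht
  exact (pow_left_inj₀ (norm_nonneg _) (norm_nonneg _) two_ne_zero).1 
    (Complex.ofReal_injective (by push_cast; exact ht))

end Shift

section Cyclic

variable {f g : L2}

/-- The smallest closed subspace of `L²(𝕋)` that contains `f` and is invariant under
multiplication by `z`. -/
def cyclicSubspace (f : L2) : Submodule ℂ L2 :=
  (Submodule.span ℂ (Set.range fun n : ℕ => fourierMul n f)).topologicalClosure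

lemma isClosed_cyclicSubspace (f : L2) : IsClosed (cyclicSubspace f : Set L2) :=
  Submodule.isClosed_topologicalClosure _

lemma fourierMul_self_mem_cyclicSubspace (f : L2) (n : ℕ) : fourierMul n f ∈ cyclicSubspace f :=
  Submodule.le_topologicalClosure _ (Submodule.subset_span ⟨n, rfl⟩)

lemma self_mem_cyclicSubspace (f : L2) : f ∈ cyclicSubspace f := by
  simpa only [Nat.cast_zero, fourierMul_zero] using fourierMul_self_mem_cyclicSubspace f 0

lemma cyclicSubspace_le {V : Submodule ℂ L2} (hV : IsClosed (V : Set L2))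
    (h : ∀ n : ℕ, fourierMul n f ∈ V) : cyclicSubspace f ≤ V :=
  Submodule.topologicalClosure_minimal _ (Submodule.span_le.2 (Set.range_subset_iff.2 h)) hV

lemma mulCLM_mem_cyclicSubspace (φ : Lp ℂ ∞ circleMeasure) (hg : g ∈ cyclicSubspace f) :
    mulCLM φ g ∈ cyclicSubspace (mulCLM φ f) := by
  have hle : cyclicSubspace f ≤ (cyclicSubspace (mulCLM φ f)).comap (mulCLM φ).toLinearMap :=
    cyclicSubspace_le ((isClosed_cyclicSubspace _).preimage (mulCLM φ).continuous) fun n => by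
      rw [Submodule.mem_comap, ContinuousLinearMap.coe_coe, ← fourierMul_mulCLM]
      exact fourierMul_self_mem_cyclicSubspace _ n
  exact hle hg

lemma fourierMul_mem_cyclicSubspace (n : ℕ) (hg : g ∈ cyclicSubspace f) :
    fourierMul n g ∈ cyclicSubspace f := by
  have hle : cyclicSubspace (fourierMul n f) ≤ cyclicSubspace f :=
    cyclicSubspace_le (isClosed_cyclicSubspace f) fun m => by
      rw [fourierMul_fourierMul]
      exact_mod_cast fourierMul_self_mem_cyclicSubspace f (m + n)
  exact hle (mulCLM_mem_cyclicSubspace _ hg)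

lemma cyclicSubspace_le_of_mem (hg : g ∈ cyclicSubspace f) :
    cyclicSubspace g ≤ cyclicSubspace f :=
  cyclicSubspace_le (isClosed_cyclicSubspace f) fun n => fourierMul_mem_cyclicSubspace n hg

lemma cyclicSubspace_one : cyclicSubspace (fourierLp 2 0 : L2) = H2 := by
  apply le_antisymm
  · refine cyclicSubspace_le isClosed_H2 fun n m hm => ?_
    rw [fourierMul_fourierLp, add_zero, fourierCoeff_congr_ae (coeFn_fourierLp 2 (n : ℤ)),
      fourierCoeff_fourier, Pi.single_eq_of_ne (by omega)]
  · intro f hf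
    refine (isClosed_cyclicSubspace _).mem_of_tendsto (hasSum_fourier_series_L2 f)
      (.of_forall fun s => Submodule.sum_mem _ fun n _ => ?_)
    obtain hn | hn := lt_or_ge n 0
    · rw [hf n hn, zero_smul]
      exact Submodule.zero_mem _
    · lift n to ℕ using hn
      have := fourierMul_self_mem_cyclicSubspace (fourierLp 2 0) n
      rw [fourierMul_fourierLp, add_zero] at this
      exact Submodule.smul_mem _ _ this

lemma fourierMul_mem_H2 (n : ℕ) (hf : f ∈ H2) : fourierMul n f ∈ H2 := by
  rw [← cyclicSubspace_one] at hf ⊢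
  exact fourierMul_mem_cyclicSubspace n hf

lemma isOuter_iff_cyclicSubspace_eq {u : L2} : IsOuter u ↔ cyclicSubspace u = H2 := by
  have hset : {f : L2 | ∃ n : ℕ, f =ᵐ[circleMeasure] fun t => fourier (n : ℤ) t * u t}
      = Set.range fun n : ℕ => fourierMul n u := by
    ext f
    refine exists_congr fun n => ⟨fun h => ?_, ?_⟩
    · exact Lp.ext ((coeFn_fourierMul n u).trans h.symm)
    · rintro rfl
      exact coeFn_fourierMul n u
  rw [IsOuter, hset]
  exact and_iff_right_of_imp fun h => h.le (self_mem_cyclicSubspace u)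

lemma isOuter_of_one_mem_cyclicSubspace {u : L2} (hu : u ∈ H2)
    (h : (fourierLp 2 0 : L2) ∈ cyclicSubspace u) : IsOuter u := by
  rw [isOuter_iff_cyclicSubspace_eq, ← cyclicSubspace_one]
  rw [← cyclicSubspace_one] at hu
  exact le_antisymm (cyclicSubspace_le_of_mem hu) (cyclicSubspace_le_of_mem h)

end Cyclic

section OuterFunctions

variable {W : L2}

lemma exists_unimodular_mem_cyclicSubspace (hW : W ∉ cyclicSubspace (fourierMul 1 W)) :
    ∃ φ ∈ cyclicSubspace W, φ ∈ (cyclicSubspace (fourierMul 1 W))ᗮ ∧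
      ∀ᵐ t ∂circleMeasure, ‖φ t‖ = 1 := by
  set N := cyclicSubspace (fourierMul 1 W)
  have : CompleteSpace N := (isClosed_cyclicSubspace _).completeSpace_coe
  have hNW : N ≤ cyclicSubspace W :=
    cyclicSubspace_le_of_mem (fourierMul_self_mem_cyclicSubspace W 1)
  set F := W - N.starProjection W with hF
  have hFmem : F ∈ cyclicSubspace W :=
    Submodule.sub_mem _ (self_mem_cyclicSubspace W) (hNW (N.starProjection_apply_mem W))
  have hForth : F ∈ Nᗮ := N.sub_starProjection_mem_orthogonal W
  have hF0 : ‖F‖ ≠ 0 := by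
    rw [norm_ne_zero_iff, hF, sub_ne_zero]
    exact fun h => hW (h ▸ N.starProjection_apply_mem W)
  have hnorm : ∀ᵐ t ∂circleMeasure, ‖F t‖ = ‖F‖ :=
    norm_ae_eq_of_inner_fourierMul_eq_zero fun n hn => by
      obtain ⟨k, rfl⟩ := Nat.exists_eq_succ_of_ne_zero hn
      have hmem : fourierMul k (fourierMul 1 F) ∈ N :=
        fourierMul_mem_cyclicSubspace k (mulCLM_mem_cyclicSubspace _ hFmem)
      rw [fourierMul_fourierMul] at hmem
      exact hForth _ (mod_cast hmem)
  refine ⟨(‖F‖⁻¹ : ℂ) • F, Submodule.smul_mem _ _ hFmem, Submodule.smul_mem _ _ hForth, ?_⟩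
  filter_upwards [Lp.coeFn_smul (‖F‖⁻¹ : ℂ) F, hnorm] with t hsmul ht
  rw [hsmul, Pi.smul_apply, norm_smul, ht, norm_inv, Complex.norm_real, norm_norm,
    inv_mul_cancel₀ hF0]

lemma isOuter_of_ae_eq_conj_mul {φ u : L2} (hφ : ∀ᵐ t ∂circleMeasure, ‖φ t‖ = 1)
    (hmem : φ ∈ cyclicSubspace W) (horth : φ ∈ (cyclicSubspace (fourierMul 1 W))ᗮ)
    (hu : u =ᵐ[circleMeasure] fun t => conj (φ t) * W t) : IsOuter u := by
  have hbdd : MemLp (star φ) ∞ circleMeasure :=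
    memLp_top_of_bound (Lp.aestronglyMeasurable φ).star 1
      (hφ.mono fun t ht => by rw [Pi.star_apply, norm_star, ht])
  have hmul : mulCLM (hbdd.toLp _) W = u := by
    apply Lp.ext
    filter_upwards [coeFn_mulCLM (hbdd.toLp _) W, hbdd.coeFn_toLp, hu] with t h₁ h₂ h₃
    rw [h₁, h₂, h₃, Pi.star_apply, Complex.star_def]
  have hone : mulCLM (hbdd.toLp _) φ = fourierLp 2 0 := by
    apply Lp.ext
    filter_upwards [coeFn_mulCLM (hbdd.toLp _) φ, hbdd.coeFn_toLp, hφ,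
      coeFn_fourierLp (T := 2 * Real.pi) 2 0] with t h₁ h₂ h₃ h₄
    rw [h₁, h₂, h₄, Pi.star_apply, Complex.star_def, Complex.conj_mul', h₃, fourier_zero,
      Complex.ofReal_one, one_pow]
  refine isOuter_of_one_mem_cyclicSubspace (fun n hn => ?_) ?_
  · obtain ⟨k, rfl⟩ : ∃ k : ℕ, n = -((k : ℤ) + 1) := ⟨(-n - 1).toNat, by omega⟩
    rw [fourierCoeff_congr_ae hu, fourierCoeff_conj_mul, inner_fourierMul_left, neg_neg,
      ← fourierMul_fourierMul]
    exact Submodule.inner_left_of_mem_orthogonal (fourierMul_self_mem_cyclicSubspace _ k) horth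
  · rw [← hone, ← hmul]
    exact mulCLM_mem_cyclicSubspace _ hmem

theorem exists_isOuter_norm_eq_of_notMem (hW : W ∉ cyclicSubspace (fourierMul 1 W)) :
    ∃ u : L2, IsOuter u ∧ ∀ᵐ t ∂circleMeasure, ‖u t‖ = ‖W t‖ := by
  obtain ⟨φ, hmem, horth, hφ⟩ := exists_unimodular_mem_cyclicSubspace hW
  have hnorm : ∀ᵐ t ∂circleMeasure, ‖conj (φ t) * W t‖ = ‖W t‖ :=
    hφ.mono fun t ht => by rw [norm_mul, RCLike.norm_conj, ht, one_mul]
  have hu : MemLp (fun t => conj (φ t) * W t) 2 circleMeasure :=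
    (Lp.memLp W).of_le ((Lp.aestronglyMeasurable φ).star.mul (Lp.aestronglyMeasurable W))
      (hnorm.mono fun _ ht => ht.le)
  refine ⟨hu.toLp _, isOuter_of_ae_eq_conj_mul hφ hmem horth hu.coeFn_toLp, ?_⟩
  filter_upwards [hu.coeFn_toLp, hnorm] with t ht htn
  rw [ht, htn]

lemma notMem_cyclicSubspace_fourierMul_one (hW : ∀ᵐ t ∂circleMeasure, W t ≠ 0)
    (hinv : MemLp (fun t => (W t)⁻¹) 2 circleMeasure) :
    W ∉ cyclicSubspace (fourierMul 1 W) := by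
  -- The conjugate of `W⁻¹` pairs to `1` with `W` and to `0` with every `z ^ (n + 1) W`.
  set k : L2 := hinv.star.toLp _
  have hk (n : ℤ) : inner ℂ k (fourierMul n W) = if n = 0 then 1 else 0 := by
    have hone : (fun t => conj (k t) * W t) =ᵐ[circleMeasure] fourier 0 := by
      filter_upwards [hW, hinv.star.coeFn_toLp] with t hWt hkt
      rw [hkt, Pi.star_apply, Complex.star_def, Complex.conj_conj, inv_mul_cancel₀ hWt,
        fourier_zero]
    rw [← neg_neg n, ← inner_fourierMul_left, ← fourierCoeff_conj_mul, fourierCoeff_congr_ae hone,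
      fourierCoeff_fourier, Pi.single_apply]
    simp only [neg_eq_zero, neg_neg]
  have hle : cyclicSubspace (fourierMul 1 W) ≤ (ℂ ∙ k)ᗮ :=
    cyclicSubspace_le (Submodule.isClosed_orthogonal _) fun n => by
      rw [Submodule.mem_orthogonal_singleton_iff_inner_right, fourierMul_fourierMul, hk,
        if_neg (by omega)]
  intro hmem
  have hWk : inner ℂ k W = 0 := Submodule.mem_orthogonal_singleton_iff_inner_right.1 (hle hmem)
  have hWk' : inner ℂ k W = 1 := by simpa only [fourierMul_zero, if_true] using hk 0
  exact zero_ne_one (hWk.symm.trans hWk')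

theorem exists_isOuter_norm_eq {w : UnitCircle → ℝ} (hw : MemLp w 2 circleMeasure)
    (hpos : ∀ᵐ t ∂circleMeasure, 0 < w t)
    (hinv : MemLp (fun t => (w t)⁻¹) 2 circleMeasure) :
    ∃ u : L2, IsOuter u ∧ ∀ᵐ t ∂circleMeasure, ‖u t‖ = w t := by
  set W : L2 := hw.ofReal.toLp _
  have hW : W =ᵐ[circleMeasure] fun t => (w t : ℂ) := hw.ofReal.coeFn_toLp
  have hW0 : ∀ᵐ t ∂circleMeasure, W t ≠ 0 := by
    filter_upwards [hW, hpos] with t ht hwt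
    rw [ht]
    exact_mod_cast hwt.ne'
  have hWinv : MemLp (fun t => (W t)⁻¹) 2 circleMeasure :=
    hinv.ofReal.ae_eq (hW.mono fun t ht => by simp only [ht, RCLike.ofReal_inv]; rfl)
  obtain ⟨u, hu, hunorm⟩ :=
    exists_isOuter_norm_eq_of_notMem (notMem_cyclicSubspace_fourierMul_one hW0 hWinv)
  refine ⟨u, hu, ?_⟩
  filter_upwards [hunorm, hW, hpos] with t hut ht hwt
  rw [hut, ht, Complex.norm_of_nonneg hwt.le]

theorem exists_isOuter_norm_eq_of_le {w : UnitCircle → ℝ} {c : ℝ} (hc : 0 < c)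
    (hw : MemLp w 2 circleMeasure) (h : ∀ᵐ t ∂circleMeasure, c ≤ w t) :
    ∃ u : L2, IsOuter u ∧ ∀ᵐ t ∂circleMeasure, ‖u t‖ = w t :=
  exists_isOuter_norm_eq hw (h.mono fun _ ht => hc.trans_le ht)
    ((memLp_top_inv hc hw.1 (h.mono fun _ ht => ht.trans (le_abs_self _))).mono_exponent le_top)

end OuterFunctions

section TruncatedToeplitz

lemma mem_H2_orthogonal_iff {x : L2} : x ∈ H2ᗮ ↔ ∀ n : ℕ, fourierCoeff x n = 0 := by
  have hmonomial (n : ℕ) : fourierMul n (fourierLp 2 0 : L2) = fourierLp 2 (n : ℤ) := by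
    rw [fourierMul_fourierLp, add_zero]
  refine ⟨fun hx n => ?_, fun hx => ?_⟩
  · rw [← inner_fourierLp, ← hmonomial]
    refine Submodule.inner_right_of_mem_orthogonal ?_ hx
    rw [← cyclicSubspace_one]
    exact fourierMul_self_mem_cyclicSubspace _ n
  · have hle : H2 ≤ (ℂ ∙ x)ᗮ := by
      rw [← cyclicSubspace_one]
      refine cyclicSubspace_le (Submodule.isClosed_orthogonal _) fun n => ?_
      rw [Submodule.mem_orthogonal_singleton_iff_inner_left, hmonomial, inner_fourierLp, hx]
    exact fun y hy => Submodule.mem_orthogonal_singleton_iff_inner_left.1 (hle hy)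

lemma star_mem_H2_orthogonal {h : L2} (hh : h ∈ H2) (h0 : fourierCoeff h 0 = 0) :
    star h ∈ H2ᗮ := by
  refine mem_H2_orthogonal_iff.2 fun n => ?_
  rw [fourierCoeff_star, map_eq_zero]
  obtain rfl | hn := eq_or_ne n 0
  · rwa [Nat.cast_zero, neg_zero]
  · exact hh _ (by omega)

lemma conj_mul_mem_H2_orthogonal {u x y : L2} (hu : u ∈ H2) (hx : x ∈ H2ᗮ)
    (hy : y =ᵐ[circleMeasure] fun t => conj (u t) * x t) : y ∈ H2ᗮ := by
  refine mem_H2_orthogonal_iff.2 fun n => ?_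
  rw [fourierCoeff_congr_ae hy, fourierCoeff_conj_mul]
  exact Submodule.inner_right_of_mem_orthogonal (fourierMul_mem_H2 n hu) hx

lemma conj_mul_mem_H2_orthogonal_of_mem_modelSpace {θ u f x : L2}
    (hθ : ∀ᵐ t ∂circleMeasure, ‖θ t‖ = 1) (hu : u ∈ H2) (hf : f ∈ modelSpace θ)
    (hx : x =ᵐ[circleMeasure] fun t => conj (θ t * u t) * f t) : x ∈ H2ᗮ := by
  obtain ⟨-, h, hh, h0, hfh⟩ := hf
  refine conj_mul_mem_H2_orthogonal hu (star_mem_H2_orthogonal hh h0) ?_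
  filter_upwards [hx, hfh, hθ, Lp.coeFn_star h] with t hxt hft hθt hstar
  rw [hxt, hft, hstar, Pi.star_apply, Complex.star_def]
  have hθθ : conj (θ t) * θ t = 1 := by
    rw [Complex.conj_mul', hθt, Complex.ofReal_one, one_pow]
  rw [map_mul]
  linear_combination conj (u t) * conj (h t) * hθθ

variable {θ : L2} (hθ : IsInner θ)

lemma modelProj_eq_zero_of_mem_H2_orthogonal {x : L2} (hx : x ∈ H2ᗮ) : modelProj hθ x = 0 := by
  have := hasOrthogonalProjection_modelSpace hθ
  have hle : modelSpace θ ≤ H2 := fun _ hf => hf.1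
  exact (modelSpace θ).orthogonalProjectionOnto_eq_zero_iff.2 (Submodule.orthogonal_le hle hx)

lemma truncatedToeplitz_domain_le {g g' : L2} {C D : ℝ}
    (h : ∀ᵐ t ∂circleMeasure, ‖g' t‖ ≤ C * ‖g t‖ + D) :
    (truncatedToeplitz hθ g).domain ≤ (truncatedToeplitz hθ g').domain := fun f hf =>
  memLp_mul_of_norm_le (Lp.memLp (f : L2)) hf (Lp.aestronglyMeasurable g') h

lemma truncatedToeplitz_eq_of_domain_eq {g g' u : L2} (hu : u ∈ H2)
    (hg' : g' =ᵐ[circleMeasure] fun t => g t - conj (θ t * u t))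
    (hdom : (truncatedToeplitz hθ g).domain = (truncatedToeplitz hθ g').domain) :
    truncatedToeplitz hθ g = truncatedToeplitz hθ g' := by
  refine LinearPMap.ext hdom fun f hf hf' => ?_
  change modelProj hθ (MemLp.toLp _ hf) = modelProj hθ (MemLp.toLp _ hf')
  rw [← sub_eq_zero, ← map_sub]
  refine modelProj_eq_zero_of_mem_H2_orthogonal hθ
    (conj_mul_mem_H2_orthogonal_of_mem_modelSpace hθ.2 hu f.2 ?_)
  filter_upwards [Lp.coeFn_sub (MemLp.toLp _ hf) (MemLp.toLp _ hf'), hf.coeFn_toLp,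
    hf'.coeFn_toLp, hg'] with t hsub ht ht' hgt
  rw [hsub, Pi.sub_apply, ht, ht', hgt]
  ring

end TruncatedToeplitz

lemma norm_sub_mem_Icc_of_norm_eq_two_mul_add_one {E : Type*} [SeminormedAddCommGroup E] {v w : E}
    (h : ‖w‖ = 2 * ‖v‖ + 1) : ‖v - w‖ ∈ Set.Icc (‖v‖ + 1) (3 * ‖v‖ + 1) := by
  have hlower := norm_sub_norm_le w v
  have hupper := norm_sub_le v w
  rw [norm_sub_rev] at hlower
  constructor <;> linarith

end

end HardyTTO

theorem mainTheorem11 (θ : L2) (hθ : IsInner θ) (g : L2) :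
    (∃ u : L2, IsOuter u ∧ ∀ᵐ t ∂circleMeasure, ‖u t‖ = 2 * ‖g t‖ + 1) ∧
    ∀ u : L2, IsOuter u → (∀ᵐ t ∂circleMeasure, ‖u t‖ = 2 * ‖g t‖ + 1) →
      ∃ g' : L2,
        (g' =ᵐ[circleMeasure] fun t => g t - conj (θ t * u t)) ∧
        truncatedToeplitz hθ g = truncatedToeplitz hθ g' ∧
        (∀ᵐ t ∂circleMeasure, g' t ≠ 0) ∧
        MemLp (fun t => (g' t)⁻¹) ∞ circleMeasure := by
  have hg : MemLp (fun t => 2 * ‖g t‖ + 1) 2 circleMeasure :=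
    ((Lp.memLp g).norm.const_mul 2).add (memLp_const 1)
  refine ⟨exists_isOuter_norm_eq_of_le one_pos hg (.of_forall fun t => ?_), fun u hu hgu => ?_⟩
  · linarith [norm_nonneg (g t)]
  have hθu : MemLp (fun t => conj (θ t * u t)) 2 circleMeasure :=
    (memLp_inner_mul hθ (Lp.memLp u)).star
  set g' : L2 := ((Lp.memLp g).sub hθu).toLp _
  have hg' : g' =ᵐ[circleMeasure] fun t => g t - conj (θ t * u t) :=
    ((Lp.memLp g).sub hθu).coeFn_toLp
  have hbounds : ∀ᵐ t ∂circleMeasure, ‖g' t‖ ∈ Set.Icc (‖g t‖ + 1) (3 * ‖g t‖ + 1) := by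
    filter_upwards [hg', hgu, hθ.2] with t ht hut hθt
    rw [ht]
    refine norm_sub_mem_Icc_of_norm_eq_two_mul_add_one ?_
    rw [RCLike.norm_conj, norm_mul, hθt, one_mul, hut]
  refine ⟨g', hg', truncatedToeplitz_eq_of_domain_eq hθ hu.1 hg' (le_antisymm ?_ ?_), ?_, ?_⟩
  · exact truncatedToeplitz_domain_le hθ (hbounds.mono fun t ht => ht.2)
  · exact truncatedToeplitz_domain_le (C := 1) (D := 0) hθ
      (hbounds.mono fun t ht => by linarith [ht.1])
  · exact hbounds.mono fun t ht => norm_pos_iff.1 (by linarith [ht.1, norm_nonneg (g t)])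
  · exact memLp_top_inv one_pos (Lp.aestronglyMeasurable g')
      (hbounds.mono fun t ht => by linarith [ht.1, norm_nonneg (g t)])
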